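/- Modal formulas are built from propositional variables $p_0,p_1,\dots$ and $\bot$ by implication $\to$ and a binary modality $\rhd$; the connectives $\neg,\vee,\top$ are defined as usual by $\neg\phi=\phi\to\bot$, $\phi\vee\psi=\neg\phi\to\psi$, $\top=\neg\bot$. **Enumerations.** Let $U$ be an effectively coded set (for example, all words in a finite alphabet). A nondeterministic partial recursive function on $U$ is a map $f$ from $U$ to subsets of $U$ whose graph $\{(x,y): y\in f(x)\}$ is recursively enumerable ($f(x)$ is the set of values that a nondeterministic machine can return on input $x$). An *enumeration of nondeterministic partial recursive functions* is an acceptable (Gödel) enumeration $\{\xi_u\}_{u\in U}$ of all of them: $\{(u,x,y): y\in\xi_u(x)\}$ is recursively enumerable, every nondeterministic partial recursive function on $U$ is some $\xi_u$, and for every $n\ge 0$ and every family $\{\eta_z\}_{z\in U^n}$ of functions from $U$ to subsets of $U$ with $\{(z,x,y): y\in\eta_z(x)\}$ recursively enumerable there is a total recursive $s:U^n\to U$ with $\xi_{s(z)}=\eta_z$ for all $z\in U^n$. **Set semantics.** A valuation $*$ assigns to each variable a subset of $U$, and is extended to all formulas by $\bot^*=\varnothing$, $(\phi\to\psi)^*=(U\setminus\phi^*)\cup\psi^*$,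 and $$(\phi\rhd\psi)^*=\{w\in U : \forall u\in\phi^*\,(\xi_w(u)\ne\varnothing\Rightarrow\xi_w(u)\cap\psi^*\neq\varnothing)\}.$$ The formula $\phi$ is a tautology of $\{\xi_u\}_{u\in U}$ if $\phi^*=U$ for every valuation $*$. **Kripke models.** A Kripke model consists of a finite set $W$ of worlds, a ternary relation $u\to_w v$ on $W$, and a relation $\Vdash$ between worlds and propositional variables. Forcing is extended to all formulas: $w\nVdash\bot$; $w\Vdash\phi\to\psi$ iff $w\nVdash\phi$ or $w\Vdash\psi$; and $w\Vdash\phi\rhd\psi$ iff for all worlds $u,v$ with $u\to_w v$ and $u\Vdash\phi$ there is a world $v'$ with $u\to_w v'$ and $v'\Vdash\psi$. **The logic $\Re$.** $\Re$ extends classical propositional logic (in this language, with Modus Ponens) by the axioms - A1: $\phi\rhd\psi\to(\chi\rhd\psi\to(\phi\vee\chi)\rhd\psi)$, - A2: $\bot\rhd\phi$, - A3: $\phi\rhd\top$, and the monotonicity rule M: from $\phi_1\to\phi_2$ and $\psi_1\to\psi_2$ infer $\phi_2\rhd\psi_1\to\phi_1\rhd\psi_2$. **Theorem.** For every modal formula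 $\phi$ and every enumeration $\{\xi_u\}_{u\in U}$ of nondeterministic partial recursive functions in the above sense, the following are equivalent: 1. $\phi$ is a tautology of $\{\xi_u\}_{u\in U}$; 2. $w\Vdash\phi$ for every world $w$ of every Kripke model; 3. $\phi$ is provable in $\Re$. -/

import Mathlib

/-! ### Nondeterministic partial recursive functions and their enumerations -/

/-- A nondeterministic function from `U` to `U` assigns to an input the set of all values that it
can return there (the empty set where it diverges). It is partial recursive when its graph is
recursively enumerable, that is, when some nondeterministic machine can return `y` on input `x`
exactly if `y ∈ f x`. -/
def IsNondetPartialRecursive {U : Type*} [Primcodable U] (f : U → Set U) : Prop :=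
  REPred fun p : U × U => p.2 ∈ f p.1

/-- A family of nondeterministic partial recursive functions that are computed by one
nondeterministic machine from the parameter and the argument. -/
def IsUniformlyNondetPartialRecursive {P U : Type*} [Primcodable P] [Primcodable U]
    (η : P → U → Set U) : Prop :=
  REPred fun p : P × U × U => p.2.2 ∈ η p.1 p.2.1

/-- An acceptable (Gödel) enumeration of all nondeterministic partial recursive functions from
`U` to `U` by the elements of `U`. -/
structure IsNondetEnumeration {U : Type*} [Primcodable U] (ξ : U → U → Set U) : Prop where
  /-- there is a universal nondeterministic machine -/
  universal : IsUniformlyNondetPartialRecursive ξ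
  /-- every nondeterministic partial recursive function is listed -/
  exhaustive : ∀ f : U → Set U, IsNondetPartialRecursive f → ∃ u, ξ u = f
  /-- the parameter (s-m-n) property -/
  smn : ∀ (n : ℕ) (η : (Fin n → U) → U → Set U), IsUniformlyNondetPartialRecursive η →
    ∃ s : (Fin n → U) → U, Computable s ∧ ∀ z, ξ (s z) = η z

/-! ### The modal language -/

/-- Modal formulas: propositional variables (numbered by `ℕ`), falsum, implication, and the binary
modality `φ ▷ ψ`. -/
inductive ModalFormula : Type
  | var : ℕ → ModalFormula
  | bot : ModalFormula
  | imp : ModalFormula → ModalFormula → ModalFormula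
  | rhd : ModalFormula → ModalFormula → ModalFormula

namespace ModalFormula

/-- negation -/
def neg (φ : ModalFormula) : ModalFormula := imp φ bot

/-- the constant true -/
def top : ModalFormula := neg bot

/-- disjunction -/
def or (φ ψ : ModalFormula) : ModalFormula := imp (neg φ) ψ

/-- The set semantics: the extension of a valuation of the variables by subsets of `U` to all
formulas, where `u` is read as a code of the function `ξ u`. -/
def interp {U : Type*} (ξ : U → U → Set U) (V : ℕ → Set U) : ModalFormula → Set U
  | var p => V p
  | bot => ∅
  | imp φ ψ => (interp ξ V φ)ᶜ ∪ interp ξ V ψ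
  | rhd φ ψ =>
      {w | ∀ u ∈ interp ξ V φ, (ξ w u).Nonempty → (ξ w u ∩ interp ξ V ψ).Nonempty}

/-- `φ` is a tautology of `ξ`: it denotes the whole universe under every valuation. -/
def IsTautologyOf {U : Type*} (ξ : U → U → Set U) (φ : ModalFormula) : Prop :=
  ∀ V : ℕ → Set U, interp ξ V φ = Set.univ

/-- Provability in the logic `ℜ`: classical propositional logic (in the first three axiom schemes
and modus ponens), the axioms A1, A2, A3 and the monotonicity rule M. -/
inductive Provable : ModalFormula → Prop
  | impK (φ ψ : ModalFormula) : Provable (imp φ (imp ψ φ))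
  | impS (φ ψ χ : ModalFormula) :
      Provable (imp (imp φ (imp ψ χ)) (imp (imp φ ψ) (imp φ χ)))
  | dne (φ : ModalFormula) : Provable (imp (neg (neg φ)) φ)
  | a1 (φ ψ χ : ModalFormula) :
      Provable (imp (rhd φ ψ) (imp (rhd χ ψ) (rhd (or φ χ) ψ)))
  | a2 (φ : ModalFormula) : Provable (rhd bot φ)
  | a3 (φ : ModalFormula) : Provable (rhd φ top)
  | mp {φ ψ : ModalFormula} : Provable (imp φ ψ) → Provable φ → Provable ψ
  | mono {φ₁ φ₂ ψ₁ ψ₂ : ModalFormula} : Provable (imp φ₁ φ₂) → Provable (imp ψ₁ ψ₂) →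
      Provable (imp (rhd φ₂ ψ₁) (rhd φ₁ ψ₂))

end ModalFormula

/-! ### Kripke models -/

/-- A Kripke model: a finite set of worlds, a ternary computability relation, and a forcing
relation between worlds and propositional variables. -/
structure KripkeModel : Type 1 where
  /-- the worlds -/
  World : Type
  finite_world : Finite World
  /-- `step w u v` stands for `u →_w v` -/
  step : World → World → World → Prop
  /-- forcing of the propositional variables -/
  forcesVar : World → ℕ → Prop

namespace KripkeModel

/-- The forcing relation between worlds and modal formulas. -/
def Forces (K : KripkeModel) : K.World → ModalFormula → Prop
  | w, .var p => K.forcesVar w p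
  | _, .bot => False
  | w, .imp φ ψ => ¬ K.Forces w φ ∨ K.Forces w ψ
  | w, .rhd φ ψ => ∀ u v, K.step w u v → K.Forces u φ →
      ∃ v', K.step w u v' ∧ K.Forces v' ψ

end KripkeModel

/-!
Soundness of `ℜ` for the set semantics only uses that `interp` is defined pointwise.

A Kripke model is copied into the enumeration by the recursion theorem: the worlds receive distinct
codes, and the code of `w` is a program that returns, on the code of `u`, the codes of all `v` with
`u →_w v`, and diverges on everything else. Under the induced valuation a world forces exactly the
formulas whose interpretation contains its code, so a tautology is forced everywhere.

For completeness, worlds are traces of maximal consistent sets on the subformulas of the given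
formula, each taken in one copy for every subformula `ψ`. Refuting `φ ▷ ψ` at `w` requires an input
`u` that forces `φ` and has some value at `w`, but none that forces `ψ`. By A1 and A2 the formulas
`χ` with `χ ▷ ψ` in `w` form an ideal that does not contain `φ`, so some maximal consistent set
contains `φ` and avoids the ideal; its copy for `ψ` is such an input, with all the worlds that
refute `ψ` as values. A3 ensures that there is one.
-/

/-! ### Closure properties of recursively enumerable predicates -/

section RecursivelyEnumerable

variable {α β ι : Type*} [Primcodable α] [Primcodable β]

theorem rePred_comp {p : β → Prop} (hp : REPred p) {f : α → β} (hf : Computable f) :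
    REPred fun a => p (f a) :=
  Partrec.comp (f := fun b => Part.assert (p b) fun _ => Part.some ()) hp hf

theorem rePred_iff_exists_computable {p : α → Prop} :
    REPred p ↔ ∃ R : α → ℕ → Bool, Computable₂ R ∧ ∀ a, p a ↔ ∃ k, R a k := by
  constructor
  · intro hp
    obtain ⟨c, hc⟩ := Nat.Partrec.Code.exists_code.1 (Partrec.bind_decode₂_iff.1 hp)
    refine ⟨fun a k => (c.evaln k (Encodable.encode a)).isSome, ?_, fun a => ?_⟩
    · exact Primrec.option_isSome.to_comp.comp <| Nat.Partrec.Code.primrec_evaln.to_comp.comp <|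
        (Computable.snd.pair (Computable.const c)).pair (Computable.encode.comp Computable.fst)
    · have eval_dom_iff : (c.eval (Encodable.encode a)).Dom ↔ p a := by
        simp [hc, Part.dom_iff_mem]
      simp only [← eval_dom_iff, Part.dom_iff_mem, Nat.Partrec.Code.evaln_complete,
        Option.isSome_iff_exists, Option.mem_def]
      exact exists_comm
  · rintro ⟨R, hR, hpR⟩
    have search : Partrec fun a => Nat.rfind fun k => Part.some (R a k) :=
      Partrec.rfind hR.partrec₂
    exact search.dom_re.of_eq fun a => Nat.rfind_dom.trans <| by
      simp [hpR]

theorem rePred_and {p q : α → Prop} (hp : REPred p) (hq : REPred q) :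
    REPred fun a => p a ∧ q a := by
  obtain ⟨R, hR, hpR⟩ := rePred_iff_exists_computable.1 hp
  obtain ⟨S, hS, hqS⟩ := rePred_iff_exists_computable.1 hq
  refine rePred_iff_exists_computable.2
    ⟨fun a k => R a k.unpair.1 && S a k.unpair.2, ?_, fun a => ?_⟩
  · have hk : Computable fun x : α × ℕ => x.2.unpair :=
      Primrec.unpair.to_comp.comp Computable.snd
    exact Primrec.and.to_comp.comp (hR.comp Computable.fst (Computable.fst.comp hk))
      (hS.comp Computable.fst (Computable.snd.comp hk))
  · simp only [hpR, hqS, Bool.and_eq_true]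
    constructor
    · rintro ⟨⟨k, hk⟩, l, hl⟩
      exact ⟨Nat.pair k l, by simpa using ⟨hk, hl⟩⟩
    · rintro ⟨k, hk, hl⟩
      exact ⟨⟨_, hk⟩, _, hl⟩

theorem rePred_or {p q : α → Prop} (hp : REPred p) (hq : REPred q) :
    REPred fun a => p a ∨ q a := by
  obtain ⟨R, hR, hpR⟩ := rePred_iff_exists_computable.1 hp
  obtain ⟨S, hS, hqS⟩ := rePred_iff_exists_computable.1 hq
  exact rePred_iff_exists_computable.2
    ⟨fun a k => R a k || S a k, Primrec.or.to_comp.comp hR hS, fun a => by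
      simp only [hpR, hqS, Bool.or_eq_true, exists_or]⟩

theorem rePred_exists {p : α → β → Prop} (hp : REPred fun x : α × β => p x.1 x.2) :
    REPred fun a => ∃ b, p a b := by
  obtain ⟨R, hR, hpR⟩ := rePred_iff_exists_computable.1 hp
  refine rePred_iff_exists_computable.2
    ⟨fun a k => ((Encodable.decode k.unpair.1 : Option β).map fun b => R (a, b) k.unpair.2).getD
      false, ?_, fun a => ?_⟩
  · have hk : Computable fun x : α × ℕ => x.2.unpair :=
      Primrec.unpair.to_comp.comp Computable.snd
    exact Primrec.option_getD.to_comp.comp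
      (Computable.option_map (Computable.decode.comp (Computable.fst.comp hk))
        (hR.comp ((Computable.fst.comp Computable.fst).pair Computable.snd)
          (Computable.snd.comp (hk.comp Computable.fst))).to₂)
      (Computable.const false)
  · constructor
    · rintro ⟨b, hb⟩
      obtain ⟨k, hk⟩ := (hpR (a, b)).1 hb
      exact ⟨Nat.pair (Encodable.encode b) k, by simpa using hk⟩
    · rintro ⟨k, hk⟩
      obtain ⟨b, -, hb⟩ : ∃ b, Encodable.decode k.unpair.1 = some b ∧ R (a, b) k.unpair.2 := by
        simpa [Option.getD_eq_iff] using hk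
      exact ⟨b, (hpR (a, b)).2 ⟨_, hb⟩⟩

theorem rePred_false : REPred fun _ : α => False :=
  (Partrec.none (σ := Unit)).dom_re.of_eq fun _ => Iff.rfl

theorem rePred_true : REPred fun _ : α => True :=
  (Partrec.some (α := α)).dom_re.of_eq fun _ => Iff.rfl

theorem rePred_exists_of_finite [Finite ι] {p : ι → α → Prop} (hp : ∀ i, REPred (p i)) :
    REPred fun a => ∃ i, p i a := by
  classical
  have := Fintype.ofFinite ι
  suffices h : ∀ s : Finset ι, REPred fun a => ∃ i ∈ s, p i a from
    (h Finset.univ).of_eq fun a => by simp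
  intro s
  induction s using Finset.induction_on with
  | empty => exact rePred_false.of_eq fun a => by simp
  | insert i s _ ih => exact (rePred_or (hp i) ih).of_eq fun a => by simp

theorem rePred_forall_of_finite [Finite ι] {p : ι → α → Prop} (hp : ∀ i, REPred (p i)) :
    REPred fun a => ∀ i, p i a := by
  classical
  have := Fintype.ofFinite ι
  suffices h : ∀ s : Finset ι, REPred fun a => ∀ i ∈ s, p i a from
    (h Finset.univ).of_eq fun a => by simp
  intro s
  induction s using Finset.induction_on with
  | empty => exact rePred_true.of_eq fun a => by simp
  | insert i s _ ih => exact (rePred_and (hp i) ih).of_eq fun a => by simp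

theorem computablePred_eq {f g : α → β} (hf : Computable f) (hg : Computable g) :
    ComputablePred fun a => f a = g a := by
  classical
  exact Computable.computablePred ((PrimrecRel.decide (Primrec.eq (α := β))).to_comp.comp hf hg)

theorem computable_fin_pi {n : ℕ} {f : Fin n → α → β} (hf : ∀ i, Computable (f i)) :
    Computable fun a i => f i a := by
  have get : Computable fun v : List.Vector β n => v.get :=
    (Primrec.fin_curry.2 Primrec.vector_get).to_comp
  exact (get.comp (Computable.vector_ofFn hf)).of_eq fun a => funext fun i => by simp

theorem computable_fst_apply {n : ℕ} (i : Fin n) : Computable fun x : (Fin n → α) × β => x.1 i :=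
  Computable.fin_app.comp Computable.fst (Computable.const i)

end RecursivelyEnumerable

/-! ### Recursion theorems -/

namespace IsNondetEnumeration

variable {U : Type*} [Primcodable U] {ξ : U → U → Set U}

theorem exists_forall_eq_singleton (hξ : IsNondetEnumeration ξ) {f : U → U} (hf : Computable f) :
    ∃ u, ∀ x, ξ u x = {f x} := by
  obtain ⟨u, hu⟩ := hξ.exhaustive (fun x => {f x})
    (computablePred_eq Computable.snd (hf.comp Computable.fst)).to_re
  exact ⟨u, congrFun hu⟩

theorem nonempty (hξ : IsNondetEnumeration ξ) : Nonempty U :=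
  let ⟨u, _⟩ := hξ.exists_forall_eq_singleton Computable.id
  ⟨u⟩

/-- Programs for the constant functions are as many as the elements of `U`, and none of them is a
program for the function that diverges everywhere. -/
theorem infinite (hξ : IsNondetEnumeration ξ) : Infinite U := by
  obtain ⟨x⟩ := hξ.nonempty
  obtain ⟨d, hd⟩ := hξ.exhaustive (fun _ => ∅) rePred_false
  choose k hk using fun y => hξ.exists_forall_eq_singleton (Computable.const y)
  have k_injective : Function.Injective k := fun y z hyz =>
    Set.singleton_injective <| by rw [← hk y x, hyz, hk z x]
  by_contra h
  have := not_infinite_iff_finite.1 h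
  obtain ⟨y, rfl⟩ := Finite.surjective_of_injective k_injective d
  simpa [hk] using congrFun hd x

theorem exists_computable_param (hξ : IsNondetEnumeration ξ) {η : U → U → Set U}
    (hη : IsUniformlyNondetPartialRecursive η) :
    ∃ s : U → U, Computable s ∧ ∀ z, ξ (s z) = η z := by
  obtain ⟨s, hs, hsη⟩ := hξ.smn 1 (fun z => η (z 0)) <| rePred_comp hη <|
    (computable_fst_apply 0).pair Computable.snd
  exact ⟨fun u => s fun _ => u, hs.comp (computable_fin_pi fun _ => Computable.id),
    fun _ => hsη _⟩

theorem exists_computable_forall_eq_biUnion (hξ : IsNondetEnumeration ξ) {f : U → Set U}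
    (hf : IsNondetPartialRecursive f) :
    ∃ q : U → U, Computable q ∧ ∀ z y, ξ (q z) y = ⋃ t ∈ f z, ξ t y := by
  have hη : IsUniformlyNondetPartialRecursive fun z y => ⋃ t ∈ f z, ξ t y := by
    have input : Computable fun x : (U × U × U) × U => (x.1.1, x.2) :=
      (Computable.fst.comp Computable.fst).pair Computable.snd
    have run : Computable fun x : (U × U × U) × U => (x.2, x.1.2) :=
      Computable.snd.pair (Computable.snd.comp Computable.fst)
    exact (rePred_exists (p := fun (x : U × U × U) t => t ∈ f x.1 ∧ x.2.2 ∈ ξ t x.2.1)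
      (rePred_and (rePred_comp hf input) (rePred_comp hξ.universal run))).of_eq fun x => by simp
  obtain ⟨q, hq, hqξ⟩ := hξ.exists_computable_param hη
  exact ⟨q, hq, fun z => congrFun (hqξ z)⟩

theorem exists_eq_apply_self (hξ : IsNondetEnumeration ξ) {η : U → U → Set U}
    (hη : IsUniformlyNondetPartialRecursive η) : ∃ e, ξ e = η e := by
  obtain ⟨s, hs, hsη⟩ := hξ.exists_computable_param hη
  obtain ⟨d, hd, hdξ⟩ := hξ.exists_computable_forall_eq_biUnion (f := fun z => ξ z z) <|
    rePred_comp hξ.universal <| Computable.fst.pair <| Computable.fst.pair Computable.snd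
  obtain ⟨u, hu⟩ := hξ.exists_forall_eq_singleton (hs.comp hd)
  exact ⟨d u, funext fun y => by simp [hdξ, hu, hsη]⟩

/-- A single self-referential program `e` lists all the
programs of the system: the `i`-th one runs whatever `e` returns on a fixed label `c i`. -/
theorem exists_forall_eq_apply_self (hξ : IsNondetEnumeration ξ) {n : ℕ}
    {η : Fin n → (Fin n → U) → U → Set U}
    (hη : ∀ i, IsUniformlyNondetPartialRecursive (η i)) :
    ∃ r : Fin n → U, ∀ i, ξ (r i) = η i r := by
  have := hξ.infinite
  let c : Fin n ↪ U := Fin.valEmbedding.trans (Infinite.natEmbedding U)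
  choose s hs hsη using fun i => hξ.smn n (η i) (hη i)
  choose q hq hqξ using fun i =>
    hξ.exists_computable_forall_eq_biUnion (f := fun e => ξ e (c i)) <|
      rePred_comp hξ.universal <|
        Computable.fst.pair <| (Computable.const (c i)).pair Computable.snd
  obtain ⟨e, he⟩ := hξ.exists_eq_apply_self
      (η := fun e x => {y | ∃ i, (x, y) = (c i, s i fun j => q j e)}) <|
    rePred_exists_of_finite fun i => ComputablePred.to_re <| computablePred_eq Computable.snd <|
      (Computable.const (c i)).pair <| (hs i).comp <|
        computable_fin_pi fun j => (hq j).comp Computable.fst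
  refine ⟨fun i => q i e, fun i => funext fun y => ?_⟩
  simp [hqξ, he, hsη]

/-- A system that is solved by programs which are not distinct instead returns constants which are
distinct. -/
theorem exists_injective_forall_eq_apply_self (hξ : IsNondetEnumeration ξ) {n : ℕ}
    {η : Fin n → (Fin n → U) → U → Set U} (hη : ∀ i, IsUniformlyNondetPartialRecursive (η i)) :
    ∃ r : Fin n → U, Function.Injective r ∧ ∀ i, ξ (r i) = η i r := by
  have := hξ.infinite
  let c : Fin n ↪ U := Fin.valEmbedding.trans (Infinite.natEmbedding U)
  have eval_eq (p : Fin n × Fin n) :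
      ComputablePred fun x : (Fin n → U) × U × U => x.1 p.1 = x.1 p.2 :=
    computablePred_eq (computable_fst_apply p.1) (computable_fst_apply p.2)
  obtain ⟨r, hr⟩ := hξ.exists_forall_eq_apply_self
    (η := fun i r x => {y |
      ((∀ p : {p : Fin n × Fin n // p.1 ≠ p.2}, r p.1.1 ≠ r p.1.2) ∧ y ∈ η i r x) ∨
      ((∃ p : {p : Fin n × Fin n // p.1 ≠ p.2}, r p.1.1 = r p.1.2) ∧ y = c i)})
    fun i => rePred_or
      (rePred_and (rePred_forall_of_finite fun p => (eval_eq p).not.to_re) (hη i))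
      (rePred_and (rePred_exists_of_finite fun p => (eval_eq p).to_re)
        (computablePred_eq (Computable.snd.comp Computable.snd) (Computable.const (c i))).to_re)
  have r_injective : Function.Injective r := by
    intro i j hij
    by_contra hne
    have clash : ∃ p : {p : Fin n × Fin n // p.1 ≠ p.2}, r p.1.1 = r p.1.2 := ⟨⟨(i, j), hne⟩, hij⟩
    have apply_eq (k : Fin n) : ξ (r k) = fun _ => {c k} := by
      simp only [hr, clash, not_forall.2 (clash.imp fun _ => not_not.2), false_and, true_and,
        false_or, Set.ofPred_eq_eq_singleton]
    have : ({c i} : Set U) = {c j} := congrFun ((apply_eq i).symm.trans (hij ▸ apply_eq j)) (c i)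
    exact hne (c.injective (Set.singleton_injective this))
  refine ⟨r, r_injective, fun i => ?_⟩
  simp [hr, r_injective.eq_iff]

end IsNondetEnumeration

/-! ### Soundness -/

namespace ModalFormula

section Semantics

variable {U : Type*} {ξ : U → U → Set U} {V : ℕ → Set U} {w : U}

theorem mem_interp_imp {φ ψ : ModalFormula} :
    w ∈ interp ξ V (imp φ ψ) ↔ (w ∈ interp ξ V φ → w ∈ interp ξ V ψ) :=
  imp_iff_not_or.symm

theorem mem_interp_neg {φ : ModalFormula} : w ∈ interp ξ V (neg φ) ↔ w ∉ interp ξ V φ :=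
  mem_interp_imp

theorem mem_interp_top : w ∈ interp ξ V top :=
  mem_interp_neg.2 (Set.notMem_empty w)

theorem mem_interp_or {φ ψ : ModalFormula} :
    w ∈ interp ξ V (or φ ψ) ↔ w ∈ interp ξ V φ ∨ w ∈ interp ξ V ψ := by
  rw [or, mem_interp_imp, mem_interp_neg, or_iff_not_imp_left]

theorem Provable.mem_interp {φ : ModalFormula} (h : Provable φ) (w : U) : w ∈ interp ξ V φ := by
  induction h generalizing w with
  | impK φ ψ => simp only [mem_interp_imp]; tauto
  | impS φ ψ χ => simp only [mem_interp_imp]; tauto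
  | dne φ => simp only [mem_interp_imp, mem_interp_neg]; tauto
  | a1 φ ψ χ =>
    rw [mem_interp_imp, mem_interp_imp]
    exact fun hφ hχ u hu => (mem_interp_or.1 hu).elim (hφ u) (hχ u)
  | a2 φ => exact fun u hu => hu.elim
  | a3 φ => exact fun u _ ⟨y, hy⟩ => ⟨y, hy, mem_interp_top⟩
  | mp _ _ ih₁ ih₂ => exact mem_interp_imp.1 (ih₁ w) (ih₂ w)
  | mono _ _ ih₁ ih₂ =>
    rw [mem_interp_imp]
    intro h u hu hne
    obtain ⟨y, hy, hyψ⟩ := h u (mem_interp_imp.1 (ih₁ u) hu) hne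
    exact ⟨y, hy, mem_interp_imp.1 (ih₂ y) hyψ⟩

theorem Provable.isTautologyOf {φ : ModalFormula} (h : Provable φ) : IsTautologyOf ξ φ :=
  fun _ => Set.eq_univ_of_forall h.mem_interp

end Semantics

end ModalFormula

/-! ### Kripke models inside an enumeration -/

namespace KripkeModel

theorem forces_imp_iff {K : KripkeModel} {w : K.World} {φ ψ : ModalFormula} :
    K.Forces w (.imp φ ψ) ↔ (K.Forces w φ → K.Forces w ψ) :=
  imp_iff_not_or.symm

/-- A faithful copy of a Kripke model among the elements of `U`, read as codes of the functions
`ξ u`: distinct worlds have distinct codes, and the function coded by a world `w` computes exactly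
the steps `u →_w v`. In particular it diverges outside the codes of worlds. -/
structure IsRealization {U : Type*} (K : KripkeModel) (ξ : U → U → Set U) (code : K.World → U) :
    Prop where
  injective : Function.Injective code
  apply_eq (w : K.World) (y : U) :
    ξ (code w) y = {y' | ∃ u v, K.step w u v ∧ y = code u ∧ y' = code v}

namespace IsRealization

variable {U : Type*} {K : KripkeModel} {ξ : U → U → Set U} {code : K.World → U}

theorem mem_apply_code_iff (hcode : K.IsRealization ξ code) {w u : K.World} {y : U} :
    y ∈ ξ (code w) (code u) ↔ ∃ v, K.step w u v ∧ y = code v := by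
  rw [hcode.apply_eq]
  constructor
  · rintro ⟨u', v, hstep, hu, hy⟩
    exact ⟨v, hcode.injective hu ▸ hstep, hy⟩
  · rintro ⟨v, hstep, hy⟩
    exact ⟨u, v, hstep, rfl, hy⟩

theorem mem_interp_iff_forces (hcode : K.IsRealization ξ code) (φ : ModalFormula) (w : K.World) :
    code w ∈ φ.interp ξ (fun p => code '' {w | K.forcesVar w p}) ↔ K.Forces w φ := by
  induction φ generalizing w with
  | var p => exact hcode.injective.mem_set_image
  | bot => exact Iff.rfl
  | imp φ ψ ihφ ihψ => rw [ModalFormula.mem_interp_imp, forces_imp_iff, ihφ, ihψ]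
  | rhd φ ψ ihφ ihψ =>
    constructor
    · intro hw u v hstep hu
      obtain ⟨y, hy, hyψ⟩ := hw (code u) ((ihφ u).2 hu)
        ⟨code v, hcode.mem_apply_code_iff.2 ⟨v, hstep, rfl⟩⟩
      obtain ⟨v', hstep', rfl⟩ := hcode.mem_apply_code_iff.1 hy
      exact ⟨v', hstep', (ihψ v').1 hyψ⟩
    · rintro hw y hy ⟨y', hy'⟩
      rw [hcode.apply_eq] at hy'
      obtain ⟨u, v, hstep, rfl, -⟩ := hy'
      obtain ⟨v', hstep', hv'⟩ := hw u v hstep ((ihφ u).1 hy)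
      exact ⟨code v', hcode.mem_apply_code_iff.2 ⟨v', hstep', rfl⟩, (ihψ v').2 hv'⟩

theorem forces_of_isTautologyOf (hcode : K.IsRealization ξ code) {φ : ModalFormula}
    (h : φ.IsTautologyOf ξ) (w : K.World) : K.Forces w φ := by
  rw [← hcode.mem_interp_iff_forces, h]
  exact Set.mem_univ _

end IsRealization

end KripkeModel

namespace IsNondetEnumeration

variable {U : Type*} [Primcodable U] {ξ : U → U → Set U}

theorem exists_isRealization (hξ : IsNondetEnumeration ξ) (K : KripkeModel) :
    ∃ code : K.World → U, K.IsRealization ξ code := by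
  have := K.finite_world
  obtain ⟨n, ⟨e⟩⟩ := Finite.exists_equiv_fin K.World
  obtain ⟨r, r_injective, hr⟩ := hξ.exists_injective_forall_eq_apply_self
    (η := fun i r y => {y' | ∃ s : {s : K.World × K.World // K.step (e.symm i) s.1 s.2},
      (y, y') = (r (e s.1.1), r (e s.1.2))})
    fun i => rePred_exists_of_finite fun s =>
      ComputablePred.to_re <| computablePred_eq Computable.snd <|
        (computable_fst_apply (e s.1.1)).pair (computable_fst_apply (e s.1.2))
  exact ⟨r ∘ e, r_injective.comp e.injective, fun w y => by
    simp only [hr, Subtype.exists, Prod.exists, Prod.mk.injEq, e.symm_apply_apply, exists_prop,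
      Function.comp_apply]⟩

end IsNondetEnumeration

/-! ### Maximal consistent sets -/

namespace ModalFormula

/-- Derivability from a set of hypotheses by modus ponens and the theorems of `ℜ`. The monotonicity
rule applies to theorems only, so that the deduction theorem holds. -/
inductive Derivable (Γ : Set ModalFormula) : ModalFormula → Prop
  | hyp {φ : ModalFormula} : φ ∈ Γ → Derivable Γ φ
  | thm {φ : ModalFormula} : Provable φ → Derivable Γ φ
  | mp {φ ψ : ModalFormula} : Derivable Γ (imp φ ψ) → Derivable Γ φ → Derivable Γ ψ

namespace Derivable

variable {Γ Δ : Set ModalFormula} {φ ψ : ModalFormula}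

theorem weaken (h : Derivable Γ φ) (hΓ : Γ ⊆ Δ) : Derivable Δ φ := by
  induction h with
  | hyp h => exact hyp (hΓ h)
  | thm h => exact thm h
  | mp _ _ ih₁ ih₂ => exact mp ih₁ ih₂

theorem weaken_insert (h : Derivable Γ φ) : Derivable (insert ψ Γ) φ :=
  h.weaken (Set.subset_insert _ _)

theorem of_mem_insert : Derivable (insert φ Γ) φ :=
  hyp (Set.mem_insert _ _)

theorem provable (h : Derivable ∅ φ) : Provable φ := by
  induction h with
  | hyp h => exact h.elim
  | thm h => exact h
  | mp _ _ ih₁ ih₂ => exact .mp ih₁ ih₂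

theorem imp_self : Derivable Γ (imp φ φ) :=
  thm (.mp (.mp (.impS φ (imp φ φ) φ) (.impK _ _)) (.impK _ _))

theorem deduction (h : Derivable (insert φ Γ) ψ) : Derivable Γ (imp φ ψ) := by
  induction h with
  | hyp h =>
    obtain rfl | h := h
    · exact imp_self
    · exact mp (thm (.impK _ _)) (hyp h)
  | thm h => exact mp (thm (.impK _ _)) (thm h)
  | mp _ _ ih₁ ih₂ => exact mp (mp (thm (.impS _ _ _)) ih₁) ih₂

theorem of_insert_neg (h : Derivable (insert (neg φ) Γ) bot) : Derivable Γ φ :=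
  mp (thm (.dne φ)) h.deduction

theorem of_bot (h : Derivable Γ bot) : Derivable Γ φ :=
  of_insert_neg h.weaken_insert

theorem exists_of_sUnion {c : Set (Set ModalFormula)} (hc : IsChain (· ⊆ ·) c) (hne : c.Nonempty)
    (h : Derivable (⋃₀ c) φ) : ∃ Γ ∈ c, Derivable Γ φ := by
  induction h with
  | hyp h =>
    obtain ⟨Γ, hΓ, h⟩ := h
    exact ⟨Γ, hΓ, hyp h⟩
  | thm h => exact hne.imp fun Γ hΓ => ⟨hΓ, thm h⟩
  | mp _ _ ih₁ ih₂ =>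
    obtain ⟨Γ, hΓ, h₁⟩ := ih₁
    obtain ⟨Δ, hΔ, h₂⟩ := ih₂
    obtain hΓΔ | hΔΓ := hc.total hΓ hΔ
    · exact ⟨Δ, hΔ, mp (h₁.weaken hΓΔ) h₂⟩
    · exact ⟨Γ, hΓ, mp h₁ (h₂.weaken hΔΓ)⟩

end Derivable

namespace Provable

variable {φ ψ : ModalFormula}

open Derivable in
theorem neg_or_left : Provable (imp (neg (or φ ψ)) (neg φ)) :=
  provable <| deduction <| deduction <|
    .mp of_mem_insert.weaken_insert <| deduction <| of_bot <|
      .mp of_mem_insert of_mem_insert.weaken_insert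

open Derivable in
theorem neg_or_right : Provable (imp (neg (or φ ψ)) (neg ψ)) :=
  provable <| deduction <| deduction <|
    .mp of_mem_insert.weaken_insert of_mem_insert.weaken_insert.deduction

open Derivable in
theorem imp_of_neg_imp_neg (h : Provable (imp (neg ψ) (neg φ))) : Provable (imp φ ψ) :=
  provable <| deduction <| of_insert_neg <|
    .mp (.mp (thm h) of_mem_insert) of_mem_insert.weaken_insert

theorem rhd_mono_left {χ : ModalFormula} (h : Provable (imp φ χ)) :
    Provable (imp (rhd χ ψ) (rhd φ ψ)) :=
  .mono h Derivable.imp_self.provable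

theorem rhd_mono_right {χ : ModalFormula} (h : Provable (imp ψ χ)) :
    Provable (imp (rhd φ ψ) (rhd φ χ)) :=
  .mono Derivable.imp_self.provable h

theorem rhd_of_right (h : Provable ψ) : Provable (rhd φ ψ) :=
  .mp (rhd_mono_right (.mp (.impK _ _) h)) (.a3 φ)

end Provable

/-- A set of formulas that is consistent with `ℜ` and decides every formula. -/
structure IsMaximalConsistent (M : Set ModalFormula) : Prop where
  not_derivable_bot : ¬ Derivable M bot
  mem_or_neg_mem (φ : ModalFormula) : φ ∈ M ∨ neg φ ∈ M

namespace IsMaximalConsistent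

variable {M : Set ModalFormula} {φ ψ χ : ModalFormula}

theorem mem_of_derivable (hM : IsMaximalConsistent M) (h : Derivable M φ) : φ ∈ M :=
  (hM.mem_or_neg_mem φ).resolve_right fun hneg => hM.not_derivable_bot (.mp (.hyp hneg) h)

theorem mem_of_provable_imp (hM : IsMaximalConsistent M) (h : Provable (imp φ ψ)) (hφ : φ ∈ M) :
    ψ ∈ M :=
  hM.mem_of_derivable (.mp (.thm h) (.hyp hφ))

theorem neg_mem_iff (hM : IsMaximalConsistent M) : neg φ ∈ M ↔ φ ∉ M :=
  ⟨fun hneg h => hM.not_derivable_bot (.mp (.hyp hneg) (.hyp h)),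
    (hM.mem_or_neg_mem φ).resolve_left⟩

theorem bot_notMem (hM : IsMaximalConsistent M) : bot ∉ M :=
  fun h => hM.not_derivable_bot (.hyp h)

theorem imp_mem_iff (hM : IsMaximalConsistent M) : imp φ ψ ∈ M ↔ (φ ∈ M → ψ ∈ M) := by
  refine ⟨fun h hφ => hM.mem_of_derivable (.mp (.hyp h) (.hyp hφ)), fun h => ?_⟩
  refine hM.mem_of_derivable (Derivable.deduction ?_)
  by_cases hφ : φ ∈ M
  · exact (Derivable.hyp (h hφ)).weaken_insert
  · exact Derivable.of_bot
      (.mp (Derivable.hyp (hM.neg_mem_iff.2 hφ)).weaken_insert .of_mem_insert)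

theorem bot_rhd_mem (hM : IsMaximalConsistent M) : rhd bot ψ ∈ M :=
  hM.mem_of_derivable (.thm (.a2 ψ))

theorem or_rhd_mem (hM : IsMaximalConsistent M) (hφ : rhd φ ψ ∈ M) (hχ : rhd χ ψ ∈ M) :
    rhd (or φ χ) ψ ∈ M :=
  hM.mem_of_derivable (.mp (.mp (.thm (.a1 _ _ _)) (.hyp hφ)) (.hyp hχ))

theorem exists_superset {Γ : Set ModalFormula} (hΓ : ¬ Derivable Γ bot) :
    ∃ M, Γ ⊆ M ∧ IsMaximalConsistent M := by
  obtain ⟨M, hΓM, hM⟩ := zorn_subset_nonempty {M | ¬ Derivable M bot}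
    (fun c hc hchain hne => ⟨⋃₀ c, fun h => by
      obtain ⟨Δ, hΔ, h⟩ := h.exists_of_sUnion hchain hne
      exact hc hΔ h, fun s hs => Set.subset_sUnion_of_mem hs⟩) Γ hΓ
  have derivable_bot_of_notMem {ψ : ModalFormula} (hψ : ψ ∉ M) : Derivable (insert ψ M) bot := by
    by_contra hcons
    exact hψ (hM.le_of_ge hcons (Set.subset_insert _ _) (Set.mem_insert _ _))
  refine ⟨M, hΓM, hM.prop, fun φ => ?_⟩
  by_contra! h
  exact hM.prop (.mp (derivable_bot_of_notMem h.2).deduction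
    (derivable_bot_of_notMem h.1).deduction)

theorem exists_mem_notMem (h : ¬ Provable (imp φ ψ)) :
    ∃ M, IsMaximalConsistent M ∧ φ ∈ M ∧ ψ ∉ M := by
  have consistent : ¬ Derivable {neg ψ, φ} bot := fun hbot =>
    h (Derivable.provable (Derivable.deduction (by simpa using hbot.of_insert_neg)))
  obtain ⟨M, hsub, hM⟩ := exists_superset consistent
  exact ⟨M, hM, hsub (by simp), hM.neg_mem_iff.1 (hsub (by simp))⟩

theorem exists_notMem (h : ¬ Provable ψ) : ∃ M, IsMaximalConsistent M ∧ ψ ∉ M := by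
  obtain ⟨M, hM, -, hψ⟩ := exists_mem_notMem (φ := top) (ψ := ψ) fun himp =>
    h (himp.mp Derivable.imp_self.provable)
  exact ⟨M, hM, hψ⟩

/-- By A1 and A2 the antecedents `χ` of the formulas `χ ▷ ψ` in `M` form an ideal. -/
theorem exists_rhd_mem_of_derivable (hM : IsMaximalConsistent M)
    (h : Derivable (neg '' {χ | rhd χ ψ ∈ M}) φ) :
    ∃ χ, rhd χ ψ ∈ M ∧ Provable (imp (neg χ) φ) := by
  induction h with
  | hyp h =>
    obtain ⟨χ, hχ, rfl⟩ := h
    exact ⟨χ, hχ, Derivable.imp_self.provable⟩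
  | thm h => exact ⟨bot, hM.bot_rhd_mem, .mp (.impK _ _) h⟩
  | mp _ _ ih₁ ih₂ =>
    obtain ⟨χ₁, hχ₁, himp⟩ := ih₁
    obtain ⟨χ₂, hχ₂, hφ⟩ := ih₂
    refine ⟨or χ₁ χ₂, hM.or_rhd_mem hχ₁ hχ₂, Derivable.provable (Derivable.deduction ?_)⟩
    exact .mp (.mp (.thm himp) (.mp (.thm .neg_or_left) .of_mem_insert))
      (.mp (.thm hφ) (.mp (.thm .neg_or_right) .of_mem_insert))

theorem exists_mem_forall_notMem (hM : IsMaximalConsistent M) (h : rhd φ ψ ∉ M) :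
    ∃ N, IsMaximalConsistent N ∧ φ ∈ N ∧ ∀ χ, rhd χ ψ ∈ M → χ ∉ N := by
  have consistent : ¬ Derivable (insert φ (neg '' {χ | rhd χ ψ ∈ M})) bot := fun hbot => by
    obtain ⟨χ, hχ, hφ⟩ := hM.exists_rhd_mem_of_derivable hbot.deduction
    exact h (hM.mem_of_provable_imp (.rhd_mono_left (.imp_of_neg_imp_neg hφ)) hχ)
  obtain ⟨N, hsub, hN⟩ := exists_superset consistent
  exact ⟨N, hN, hsub (Set.mem_insert _ _), fun χ hχ =>
    hN.neg_mem_iff.1 (hsub (Set.mem_insert_of_mem _ ⟨χ, hχ, rfl⟩))⟩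

end IsMaximalConsistent

/-! ### The finite canonical model -/

/-- The set of subformulas of a formula, the formula itself included. -/
def subformulas : ModalFormula → Set ModalFormula
  | var p => {var p}
  | bot => {bot}
  | imp φ ψ => insert (imp φ ψ) (subformulas φ ∪ subformulas ψ)
  | rhd φ ψ => insert (rhd φ ψ) (subformulas φ ∪ subformulas ψ)

theorem finite_subformulas (φ : ModalFormula) : (subformulas φ).Finite := by
  induction φ with
  | var p => exact Set.finite_singleton _
  | bot => exact Set.finite_singleton _
  | imp φ ψ ihφ ihψ => exact (ihφ.union ihψ).insert _
  | rhd φ ψ ihφ ihψ => exact (ihφ.union ihψ).insert _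

theorem mem_subformulas_self (φ : ModalFormula) : φ ∈ subformulas φ := by
  cases φ <;> simp [subformulas]

theorem subformulas_subset {φ θ : ModalFormula} (h : φ ∈ subformulas θ) :
    subformulas φ ⊆ subformulas θ := by
  induction θ with
  | var p => obtain rfl : φ = _ := h; exact subset_rfl
  | bot => obtain rfl : φ = _ := h; exact subset_rfl
  | imp θ₁ θ₂ ih₁ ih₂ | rhd θ₁ θ₂ ih₁ ih₂ =>
    obtain rfl | h | h := h
    · exact subset_rfl
    · exact (ih₁ h).trans (Set.subset_union_left.trans (Set.subset_insert _ _))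
    · exact (ih₂ h).trans (Set.subset_union_right.trans (Set.subset_insert _ _))

theorem mem_subformulas_of_imp {φ ψ θ : ModalFormula} (h : imp φ ψ ∈ subformulas θ) :
    φ ∈ subformulas θ ∧ ψ ∈ subformulas θ :=
  ⟨subformulas_subset h (.inr (.inl (mem_subformulas_self φ))),
    subformulas_subset h (.inr (.inr (mem_subformulas_self ψ)))⟩

theorem mem_subformulas_of_rhd {φ ψ θ : ModalFormula} (h : rhd φ ψ ∈ subformulas θ) :
    φ ∈ subformulas θ ∧ ψ ∈ subformulas θ :=
  ⟨subformulas_subset h (.inr (.inl (mem_subformulas_self φ))),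
    subformulas_subset h (.inr (.inr (mem_subformulas_self ψ)))⟩

/-- A world of the canonical model for the subformulas of `θ`: the trace of a maximal consistent
set on the subformulas of `θ`, together with a subformula `avoided`, which is to be false at all
the values that are computed from the world as an input. A trace thus comes in one copy for every
formula that may have to be avoided. -/
structure CanonicalWorld (θ : ModalFormula) : Type where
  trace : Set ModalFormula
  avoided : ModalFormula
  exists_trace_eq : ∃ M, IsMaximalConsistent M ∧ trace = M ∩ subformulas θ
  avoided_mem : avoided ∈ subformulas θ

namespace CanonicalWorld

variable {θ : ModalFormula}

/-- The world given by the trace of the maximal consistent set `M`, in the copy that asks its values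
to refute `ψ`. -/
def ofMaximalConsistent {M : Set ModalFormula} (hM : IsMaximalConsistent M) {ψ : ModalFormula}
    (hψ : ψ ∈ subformulas θ) : CanonicalWorld θ :=
  ⟨M ∩ subformulas θ, ψ, ⟨M, hM, rfl⟩, hψ⟩

theorem finite : Finite (CanonicalWorld θ) := by
  have finite_traces : (𝒫 subformulas θ).Finite := (finite_subformulas θ).finite_subsets
  have := (finite_traces.prod (finite_subformulas θ)).to_subtype
  refine Finite.of_injective
    (fun w : CanonicalWorld θ => (⟨(w.trace, w.avoided), ?_, w.avoided_mem⟩ :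
      ((𝒫 subformulas θ) ×ˢ subformulas θ : Set (Set ModalFormula × ModalFormula)))) ?_
  · obtain ⟨M, -, hw⟩ := w.exists_trace_eq
    exact hw.trans_subset Set.inter_subset_right
  · rintro ⟨⟩ ⟨⟩ h
    simpa using congrArg Subtype.val h

end CanonicalWorld

/-- The canonical model for the subformulas of `θ`. An input `u` may be mapped to any world that
refutes `u.avoided`, unless a formula `φ ▷ ψ` of `w` applies to `u` and forces `u.avoided` on the
promised value; in that case `w` diverges on `u`. -/
def canonicalModel (θ : ModalFormula) : KripkeModel where
  World := CanonicalWorld θ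
  finite_world := CanonicalWorld.finite
  step w u v := u.avoided ∉ v.trace ∧
    ∀ φ ψ, rhd φ ψ ∈ w.trace → φ ∈ u.trace → ¬ Provable (imp ψ u.avoided)
  forcesVar w p := var p ∈ w.trace

namespace canonicalModel

variable {θ φ ψ : ModalFormula}

theorem exists_step_of_rhd_mem (hψ : ψ ∈ subformulas θ) {w u v : CanonicalWorld θ}
    (hw : rhd φ ψ ∈ w.trace) (hstep : (canonicalModel θ).step w u v) (hu : φ ∈ u.trace) :
    ∃ v' : CanonicalWorld θ, (canonicalModel θ).step w u v' ∧ ψ ∈ v'.trace := by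
  obtain ⟨N, hN, hψN, havoid⟩ := IsMaximalConsistent.exists_mem_notMem (hstep.2 φ ψ hw hu)
  exact ⟨.ofMaximalConsistent hN hψ, ⟨fun h => havoid h.1, hstep.2⟩, hψN, hψ⟩

theorem exists_step_of_rhd_notMem (h : rhd φ ψ ∈ subformulas θ) {w : CanonicalWorld θ}
    (hw : rhd φ ψ ∉ w.trace) :
    ∃ u v : CanonicalWorld θ, (canonicalModel θ).step w u v ∧ φ ∈ u.trace ∧ u.avoided = ψ := by
  obtain ⟨hφ, hψ⟩ := mem_subformulas_of_rhd h
  obtain ⟨M, hM, hwM⟩ := w.exists_trace_eq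
  have hM_rhd : rhd φ ψ ∉ M := fun hmem => hw (hwM ▸ ⟨hmem, h⟩)
  obtain ⟨N, hN, hφN, hNψ⟩ := hM.exists_mem_forall_notMem hM_rhd
  obtain ⟨L, hL, hψL⟩ := IsMaximalConsistent.exists_notMem fun hprov : Provable ψ =>
    hM_rhd (hM.mem_of_derivable (.thm hprov.rhd_of_right))
  refine ⟨.ofMaximalConsistent hN hψ, .ofMaximalConsistent hL hψ,
    ⟨fun hmem => hψL hmem.1, fun α β hαβ hα hprov => ?_⟩, ⟨hφN, hφ⟩, rfl⟩
  have hαψ : rhd α ψ ∈ M := hM.mem_of_provable_imp (.rhd_mono_right hprov) (hwM ▸ hαβ).1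
  exact hNψ α hαψ hα.1

theorem forces_iff_mem_trace (hφ : φ ∈ subformulas θ) (w : CanonicalWorld θ) :
    (canonicalModel θ).Forces w φ ↔ φ ∈ w.trace := by
  induction φ generalizing w with
  | var p => exact Iff.rfl
  | bot =>
    obtain ⟨M, hM, hwM⟩ := w.exists_trace_eq
    exact iff_of_false id fun h => hM.bot_notMem (hwM ▸ h).1
  | imp φ ψ ihφ ihψ =>
    obtain ⟨hφ', hψ'⟩ := mem_subformulas_of_imp hφ
    obtain ⟨M, hM, hwM⟩ := w.exists_trace_eq
    refine KripkeModel.forces_imp_iff.trans ?_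
    rw [ihφ hφ', ihψ hψ', hwM]
    simp only [Set.mem_inter_iff, hφ, hφ', hψ', and_true, hM.imp_mem_iff]
  | rhd φ ψ ihφ ihψ =>
    obtain ⟨hφ', hψ'⟩ := mem_subformulas_of_rhd hφ
    constructor
    · intro hforces
      by_contra hw
      obtain ⟨u, v, hstep, hu, rfl⟩ := exists_step_of_rhd_notMem hφ hw
      obtain ⟨v', hstep', hv'⟩ := hforces u v hstep ((ihφ hφ' u).2 hu)
      exact hstep'.1 ((ihψ hψ' v').1 hv')
    · intro hw u v hstep hu
      obtain ⟨v', hstep', hv'⟩ := exists_step_of_rhd_mem hψ' hw hstep ((ihφ hφ' u).1 hu)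
      exact ⟨v', hstep', (ihψ hψ' v').2 hv'⟩

end canonicalModel

theorem provable_of_forall_forces {φ : ModalFormula}
    (h : ∀ (K : KripkeModel) (w : K.World), K.Forces w φ) : Provable φ := by
  by_contra hφ
  obtain ⟨M, hM, hφM⟩ := IsMaximalConsistent.exists_notMem hφ
  have hself := mem_subformulas_self φ
  exact hφM ((canonicalModel.forces_iff_mem_trace hself (.ofMaximalConsistent hM hself)).1
    (h (canonicalModel φ) _)).1

end ModalFormula

theorem mainTheorem1 {U : Type*} [Primcodable U] (ξ : U → U → Set U)
    (hξ : IsNondetEnumeration ξ) (φ : ModalFormula) :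
    List.TFAE [
      ModalFormula.IsTautologyOf ξ φ,
      ∀ (K : KripkeModel) (w : K.World), K.Forces w φ,
      ModalFormula.Provable φ] := by
  tfae_have 1 → 2 := fun h K =>
    let ⟨_, hcode⟩ := hξ.exists_isRealization K
    hcode.forces_of_isTautologyOf h
  tfae_have 2 → 3 := ModalFormula.provable_of_forall_forces
  tfae_have 3 → 1 := ModalFormula.Provable.isTautologyOf
  tfae_finish
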